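/- All graphs are finite and simple. A graph $G$ is a Ramsey graph for cyclicity if every colouring of the edges of $G$ with two colours admits a monochromatic cycle (of any length). Let $\mathcal{M}(\mathcal{C})$ denote the class of minimal such graphs: those Ramsey graphs $G$ for cyclicity such that no proper subgraph of $G$ is a Ramsey graph for cyclicity. Theorem 1.5. If $G\in\mathcal{M}(\mathcal{C})$, then also $G^*\in\mathcal{M}(\mathcal{C})$ for every graph $G^*$ obtained from $G$ by applying one of the following three constructions: (1) Given a path $uvw$ in $G$ (that is, distinct vertices $u,v,w$ such that $uv$ and $vw$ are edges of $G$), introduce a new vertex $x$, join $x$ to each of $u$, $v$ and $w$, and then delete the edge $vw$. (2) Given an edge $vw$ of $G$, introduce a new vertex $x$, join $x$ to both $v$ and $w$, and then apply construction (1) to the path $xvw$. (Thus the edge $vw$ is replaced by a diamond, i.e. $K_4$ minus an edge, whose two non-adjacent vertices are $v$ and $w$.) (3) Given a path $uvw$ in $G$, introduce two new vertices $x,y$, join both $x$ and $y$ to each of $u$, $v$ and $w$, and then delete the edges $uv$ and $vw$. -/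

import Mathlib

/-- `G` is an `r`-Ramsey graph for cyclicity: in every colouring of its edges with `r` colours, some
colour class (as a spanning subgraph of `G`) contains a cycle, i.e. there is a monochromatic cycle,
whose length may depend on the colouring. -/
def IsCyclicityRamsey {V : Type*} (r : ℕ) (G : SimpleGraph V) : Prop :=
  ∀ c : G.EdgeLabeling (Fin r), ∃ i : Fin r, ∃ (a : V) (p : (c.labelGraph i).Walk a a), p.IsCycle

/-- `G` is a minimal `r`-Ramsey graph for cyclicity: it is an `r`-Ramsey graph for cyclicity, and no
proper subgraph of `G` (obtained by removing vertices or edges or both) is one. -/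
def IsMinimalCyclicityRamsey {V : Type*} (r : ℕ) (G : SimpleGraph V) : Prop :=
  IsCyclicityRamsey r G ∧ ∀ H : G.Subgraph, H ≠ ⊤ → ¬ IsCyclicityRamsey r H.coe

/-- The graph obtained from `G` by introducing one new vertex (`none`; the old vertices are the
`some a`) and joining it to exactly the old vertices in `S`. -/
def joinNewVertex {V : Type*} (G : SimpleGraph V) (S : Set V) : SimpleGraph (Option V) where
  Adj
    | some a, some b => G.Adj a b
    | some a, none => a ∈ S
    | none, some b => b ∈ S
    | none, none => False
  symm := ⟨by rintro (_ | a) (_ | b) h <;> first | exact h | exact SimpleGraph.Adj.symm h⟩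
  loopless := ⟨by rintro (_ | a) h <;> first | exact h | exact G.loopless.irrefl a h⟩

/-- First construction, for a 2-path `u v w`: introduce a new vertex, join it to `u`, `v` and `w`,
then delete the edge `vw`. -/
def pathExtension {V : Type*} (G : SimpleGraph V) (u v w : V) : SimpleGraph (Option V) :=
  (joinNewVertex G {u, v, w}).deleteEdges {s(some v, some w)}

/-- Second construction, for an edge `vw`: introduce a new vertex `x`, join it to `v` and `w`, then
apply the first construction to the 2-path `x v w`. -/
def diamondExtension {V : Type*} (G : SimpleGraph V) (v w : V) :
    SimpleGraph (Option (Option V)) :=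
  pathExtension (joinNewVertex G {v, w}) none (some v) (some w)

/-- Third construction, for a 2-path `u v w`: introduce two new vertices, join both of them to each
of `u`, `v` and `w`, then delete the edges `uv` and `vw`. -/
def doublePathExtension {V : Type*} (G : SimpleGraph V) (u v w : V) :
    SimpleGraph (Option (Option V)) :=
  (joinNewVertex (joinNewVertex G {u, v, w}) {some u, some v, some w}).deleteEdges
    {s(some (some u), some (some v)), s(some (some v), some (some w))}

/-! A 2-colouring without a monochromatic cycle is a decomposition of the edges into two forests. By
Nash-Williams (`IsSparse.exists_forests`, `not_isCyclicityRamsey_two_iff`) it exists iff every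
nonempty vertex set `U` spans at most `2|U| - 2` edges. Hence the minimal Ramsey graphs are those
with exactly `2|V| - 1` edges in which every nonempty proper `U` still obeys this bound
(`isMinimalCyclicityRamsey_two_iff`). The theorem then becomes a count: each construction adds two
edges per new vertex, and the bound for a proper `U` follows from the bound for its trace on the old
vertices.

Nash-Williams is proved by induction on the number of vertices, removing a vertex `x` of degree at
most three. In degree three, two edges `xa`, `xb` are first replaced by `ab`, for a pair that keeps
sparsity (`IsSparse.split_off`); afterwards `ab` is subdivided in its forest and the third edge
becomes pendant in the other. Splitting off may create parallel edges, hence the use of multisets of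
edges. -/

open Classical in
/-- The number of edges, with multiplicity, of the multigraph `M` inside the vertex set `U`. -/
noncomputable def edgesWithin {V : Type*} (M : Multiset (Sym2 V)) (U : Finset V) : ℕ :=
  M.countP (fun e => ∀ x ∈ e, x ∈ U)

/-- Every nonempty vertex set `U` spans at most `k (|U| - 1)` edges of the multigraph `M`. -/
def IsSparse {V : Type*} (k : ℕ) (M : Multiset (Sym2 V)) : Prop :=
  ∀ U : Finset V, U.Nonempty → edgesWithin M U + k ≤ k * U.card

/-! ### Sparse multigraphs and the Nash-Williams theorem for two forests. -/

section Multigraph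

variable {V : Type*} {M N : Multiset (Sym2 V)} {U W : Finset V} {k : ℕ} {x a b c : V}

lemma edgesWithin_zero : edgesWithin (0 : Multiset (Sym2 V)) U = 0 := rfl

lemma edgesWithin_add : edgesWithin (M + N) U = edgesWithin M U + edgesWithin N U := by
  classical exact Multiset.countP_add ..

open Classical in
lemma edgesWithin_cons :
    edgesWithin (s(a, b) ::ₘ M) U = edgesWithin M U + if a ∈ U ∧ b ∈ U then 1 else 0 := by
  simp [edgesWithin, Multiset.countP_cons]

lemma edgesWithin_mono_right (h : U ⊆ W) : edgesWithin M U ≤ edgesWithin M W := by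
  classical
  simp only [edgesWithin, Multiset.countP_eq_card_filter]
  exact Multiset.card_le_card (Multiset.monotone_filter_right _ fun e he y hy => h (he y hy))

lemma edgesWithin_mono_left (h : M ≤ N) : edgesWithin M U ≤ edgesWithin N U := by
  classical exact Multiset.countP_le_of_le _ h

lemma IsSparse.mono (hN : IsSparse k N) (h : M ≤ N) : IsSparse k M := fun U hU =>
  (Nat.add_le_add_right (edgesWithin_mono_left h) k).trans (hN U hU)

-- Supermodularity, checked edge by edge: an edge inside both sets is inside their intersection, and
-- an edge inside one is inside the union.
open Classical in
lemma edgesWithin_add_le_union_add_inter :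
    edgesWithin M U + edgesWithin M W ≤ edgesWithin M (U ∪ W) + edgesWithin M (U ∩ W) := by
  induction M using Multiset.induction with
  | empty => simp [edgesWithin_zero]
  | cons e M ih =>
    induction e with | _ a b
    simp only [edgesWithin_cons, Finset.mem_union, Finset.mem_inter]
    split_ifs <;> first | omega | tauto

open Classical in
lemma edgesWithin_erase_of_forall_notMem (h : ∀ e ∈ M, x ∉ e) :
    edgesWithin M (U.erase x) = edgesWithin M U := by
  refine Multiset.countP_congr rfl fun e he => ?_
  refine propext <| forall₂_congr fun y hy => ?_
  simp only [Finset.mem_erase, and_iff_right_iff_imp]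
  rintro - rfl
  exact h e he hy

lemma edgesWithin_empty : edgesWithin M ∅ = 0 := by
  classical
  rw [edgesWithin, Multiset.countP_eq_zero]
  intro e _ h
  induction e with | _ a b
  simpa using h a (by simp)

/-- Tight sets of a sparse multigraph are closed under unions of intersecting pairs. -/
lemma IsSparse.tight_union [DecidableEq V] (hM : IsSparse k M) (hne : (U ∩ W).Nonempty)
    (hU : k * U.card ≤ edgesWithin M U + k) (hW : k * W.card ≤ edgesWithin M W + k) :
    k * (U ∪ W).card ≤ edgesWithin M (U ∪ W) + k := by
  have h₁ := hM _ hne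
  have h₂ : edgesWithin M U + edgesWithin M W ≤ edgesWithin M (U ∪ W) + edgesWithin M (U ∩ W) := by
    convert edgesWithin_add_le_union_add_inter
  have h₃ := congrArg (k * ·) (Finset.card_union_add_card_inter U W)
  simp only [mul_add] at h₃
  omega

/-- If adding the edge `ab` destroys sparsity, then `a` and `b` lie in a common tight set. -/
lemma IsSparse.exists_tight_of_not_cons (hM : IsSparse k M) (h : ¬ IsSparse k (s(a, b) ::ₘ M)) :
    ∃ U : Finset V, a ∈ U ∧ b ∈ U ∧ k * U.card ≤ edgesWithin M U + k := by
  classical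
  simp only [IsSparse, not_forall, edgesWithin_cons] at h
  obtain ⟨U, hU, h⟩ := h
  have := hM U hU
  refine ⟨U, ?_⟩
  split_ifs at h with hab
  · exact ⟨hab.1, hab.2, by omega⟩
  · omega

/-- Attaching a pendant edge to a forest gives a forest. -/
lemma IsSparse.cons_of_forall_notMem (hM : IsSparse 1 M) (hx : ∀ e ∈ M, x ∉ e) (ha : a ≠ x) :
    IsSparse 1 (s(x, a) ::ₘ M) := by
  classical
  intro U hU
  have h₁ := hM U hU
  rw [edgesWithin_cons]
  split_ifs with h
  · have h₂ := hM (U.erase x) ⟨a, by simp [ha, h.2]⟩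
    rw [edgesWithin_erase_of_forall_notMem hx, Finset.card_erase_of_mem h.1] at h₂
    omega
  · omega

/-- Subdividing an edge of a forest gives a forest. -/
lemma IsSparse.subdivide (hM : IsSparse 1 (s(a, b) ::ₘ M)) (hx : ∀ e ∈ M, x ∉ e) (ha : a ≠ x)
    (hb : b ≠ x) : IsSparse 1 (s(x, a) ::ₘ s(x, b) ::ₘ M) := by
  classical
  intro U hU
  have h₁ := hM U hU
  simp only [edgesWithin_cons] at h₁ ⊢
  -- If `U` contains `x` and an end of `ab`, the bound for `U` without `x` leaves room for the one
  -- edge that the subdivision adds. Otherwise neither new edge lies inside `U`.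
  by_cases hxU : x ∈ U
  · by_cases hab : a ∈ U ∨ b ∈ U
    · have h₂ := hM (U.erase x) (by
        rcases hab with h | h
        exacts [⟨a, by simp [ha, h]⟩, ⟨b, by simp [hb, h]⟩])
      rw [edgesWithin_cons, edgesWithin_erase_of_forall_notMem hx,
        Finset.card_erase_of_mem hxU] at h₂
      simp only [Finset.mem_erase, ne_eq, ha, hb, not_false_eq_true, true_and] at h₂
      have := Finset.card_pos.2 hU
      split_ifs at h₁ h₂ ⊢ <;> first | omega | tauto
    · split_ifs at h₁ ⊢ <;> first | omega | tauto
  · split_ifs at h₁ ⊢ <;> first | omega | tauto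

-- The handshake bound; it is only an inequality because loops are counted once and ends outside `S`
-- are ignored.
open Classical in
lemma sum_countP_mem_le (M : Multiset (Sym2 V)) (S : Finset V) :
    ∑ x ∈ S, M.countP (x ∈ ·) ≤ 2 * M.card := by
  induction M using Multiset.induction with
  | empty => simp
  | cons e M ih =>
    induction e with | _ a b
    simp only [Multiset.countP_cons, Finset.sum_add_distrib, Multiset.card_cons, mul_add]
    refine Nat.add_le_add ih ?_
    rw [← Finset.card_filter]
    refine (Finset.card_le_card (t := {a, b}) fun y hy => ?_).trans Finset.card_le_two
    simpa using (Finset.mem_filter.1 hy).2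

open Classical in
/-- A nonempty sparse multigraph has a vertex of degree at most three. -/
lemma IsSparse.exists_countP_mem_le_three (hM : IsSparse 2 M) (hU : U.Nonempty)
    (hMU : ∀ e ∈ M, ∀ x ∈ e, x ∈ U) : ∃ x ∈ U, M.countP (x ∈ ·) ≤ 3 := by
  -- Degrees of at least four everywhere would give `4|U| ≤ 2|M| ≤ 4|U| - 4`.
  by_contra! h
  have h₁ := Finset.sum_le_sum fun x hx => Nat.succ_le_of_lt (h x hx)
  have h₂ := sum_countP_mem_le M U
  have h₃ : edgesWithin M U = M.card := Multiset.countP_eq_card.2 hMU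
  have h₄ := hM U hU
  simp at h₁
  omega

/-- The edges of a loopless multigraph at a vertex `x`, listed by their other ends. -/
lemma exists_map_eq_filter_mem (hM : IsSparse 2 M) (x : V) [DecidablePred (x ∈ · : Sym2 V → Prop)] :
    ∃ N : Multiset V, (∀ a ∈ N, a ≠ x) ∧ M.filter (x ∈ ·) = N.map (fun a => s(x, a)) := by
  classical
  refine ⟨(M.filter (x ∈ ·)).attach.map fun e =>
    Sym2.Mem.other (a := x) (z := e.1) (Multiset.of_mem_filter (p := (x ∈ ·)) e.2), ?_, ?_⟩
  · simp only [Multiset.mem_map, Multiset.mem_attach, true_and, Subtype.exists]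
    rintro a ⟨e, he, rfl⟩ h
    have hx := (Multiset.mem_filter.1 he).2
    have h₁ := Sym2.other_spec hx
    -- Sparsity of a singleton, `e + 2 ≤ 2`, rules out loops.
    have h₂ := hM {x} (by simp)
    rw [h] at h₁
    have h₃ : 0 < edgesWithin M {x} := Multiset.countP_pos.2
      ⟨e, Multiset.mem_of_mem_filter he, by rw [← h₁]; simp⟩
    simp at h₂
    omega
  · conv_lhs => rw [← Multiset.attach_map_val (M.filter (x ∈ ·))]
    rw [Multiset.map_map]
    exact Multiset.map_congr rfl fun e _ => (Sym2.other_spec _).symm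

/-- If `x` is a vertex with the three neighbours `a`, `b`, `c` of a sparse multigraph, then the
multigraph without `x` can be extended by `ab` or by `bc`. -/
lemma IsSparse.split_off (hM : IsSparse 2 (s(x, a) ::ₘ s(x, b) ::ₘ s(x, c) ::ₘ M)) :
    IsSparse 2 (s(a, b) ::ₘ M) ∨ IsSparse 2 (s(b, c) ::ₘ M) := by
  classical
  have hM' : IsSparse 2 M := hM.mono <|
    (Multiset.le_cons_self _ _).trans <| (Multiset.le_cons_self _ _).trans <|
      Multiset.le_cons_self _ _
  by_contra! h
  obtain ⟨U, haU, hbU, hU⟩ := hM'.exists_tight_of_not_cons h.1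
  obtain ⟨W, hbW, hcW, hW⟩ := hM'.exists_tight_of_not_cons h.2
  -- The two tight sets share `b`, so `T = U ∪ W` is tight and contains all three neighbours. Adding
  -- `x` then gives at least `2|T| - 2 + 3` edges on at most `|T| + 1` vertices, which is one too
  -- many.
  have h₁ := hM'.tight_union ⟨b, Finset.mem_inter.2 ⟨hbU, hbW⟩⟩ hU hW
  have h₂ := hM (insert x (U ∪ W)) (by simp)
  have h₃ : edgesWithin M (U ∪ W) ≤ edgesWithin M (insert x (U ∪ W)) :=
    edgesWithin_mono_right (Finset.subset_insert _ _)
  have h₄ := Finset.card_insert_le x (U ∪ W)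
  have h₅ : a ∈ U ∪ W := Finset.mem_union_left _ haU
  have h₆ : b ∈ U ∪ W := Finset.mem_union_left _ hbU
  have h₇ : c ∈ U ∪ W := Finset.mem_union_right _ hcW
  simp only [edgesWithin_cons, Finset.mem_insert, true_or, h₅, h₆, h₇, or_true, and_self,
    if_true] at h₂
  omega

/-- Undoing the splitting off of the pair `xa`, `xb` at a vertex `x` of degree three in a
decomposition into two forests. -/
lemma exists_forests_of_split_off (hx : ∀ e ∈ M, x ∉ e) (ha : a ≠ x) (hb : b ≠ x) (hc : c ≠ x)
    (h : ∃ A B, s(a, b) ::ₘ M = A + B ∧ IsSparse 1 A ∧ IsSparse 1 B) :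
    ∃ A B, s(x, a) ::ₘ s(x, b) ::ₘ s(x, c) ::ₘ M = A + B ∧ IsSparse 1 A ∧ IsSparse 1 B := by
  obtain ⟨A, B, hAB, hA, hB⟩ := h
  wlog hmem : s(a, b) ∈ A generalizing A B
  · refine this B A (by rw [hAB, add_comm]) hB hA ?_
    have := Multiset.mem_cons_self (s(a, b)) M
    rw [hAB, Multiset.mem_add] at this
    exact this.resolve_left hmem
  obtain ⟨A, rfl⟩ := Multiset.exists_cons_of_mem hmem
  rw [Multiset.cons_add, Multiset.cons_inj_right] at hAB
  subst hAB
  refine ⟨s(x, a) ::ₘ s(x, b) ::ₘ A, s(x, c) ::ₘ B,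
    by simp only [Multiset.cons_add, Multiset.add_cons, Multiset.cons_swap (s(x, c))],
    hA.subdivide (fun e he => hx e (by simp [he])) ha hb,
    hB.cons_of_forall_notMem (fun e he => hx e (by simp [he])) hc⟩

/-- The Nash-Williams theorem on arboricity two, for multigraphs. -/
theorem IsSparse.exists_forests (hM : IsSparse 2 M) (hMU : ∀ e ∈ M, ∀ x ∈ e, x ∈ U) :
    ∃ A B, M = A + B ∧ IsSparse 1 A ∧ IsSparse 1 B := by
  classical
  induction hn : U.card generalizing U M with
  | zero =>
    refine ⟨0, 0, ?_, fun W hW => ?_, fun W hW => ?_⟩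
    · refine Multiset.eq_zero_of_forall_notMem fun e he => ?_
      induction e with | _ a b
      simpa [Finset.card_eq_zero.1 hn] using hMU _ he a (by simp)
    all_goals simpa [edgesWithin_zero] using Finset.card_pos.2 hW
  | succ n ih =>
    obtain ⟨x, hxU, hx⟩ := hM.exists_countP_mem_le_three (Finset.card_pos.1 (by omega)) hMU
    obtain ⟨N, hN, hNM⟩ := exists_map_eq_filter_mem hM x
    rw [Multiset.countP_eq_card_filter, hNM, Multiset.card_map] at hx
    have hdec := Multiset.filter_add_not (x ∈ ·) M
    rw [hNM] at hdec
    set M' := M.filter (x ∉ ·) with hM'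
    have hxM' : ∀ e ∈ M', x ∉ e := fun e he => (Multiset.mem_filter.1 he).2
    have hM'U : ∀ e ∈ M', ∀ y ∈ e, y ∈ U.erase x := fun e he y hy => Finset.mem_erase.2
      ⟨fun h => hxM' e he (h ▸ hy), hMU e (Multiset.mem_of_mem_filter he) y hy⟩
    have hNU : ∀ a ∈ N, a ∈ U.erase x := fun a ha => Finset.mem_erase.2 ⟨hN a ha,
      hMU s(x, a) (by
        rw [← hdec]
        exact Multiset.mem_add.2 (.inl (Multiset.mem_map_of_mem _ ha))) a (by simp)⟩
    have hcard : (U.erase x).card = n := by rw [Finset.card_erase_of_mem hxU]; omega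
    have hM's : IsSparse 2 M' := hM.mono (Multiset.filter_le _ _)
    have extend : ∀ a ∈ N, ∀ b ∈ N, IsSparse 2 (s(a, b) ::ₘ M') →
        ∃ A B, s(a, b) ::ₘ M' = A + B ∧ IsSparse 1 A ∧ IsSparse 1 B := fun a ha b hb h =>
      ih h (by
        intro e he y hy
        rcases Multiset.mem_cons.1 he with rfl | he
        · rcases Sym2.mem_iff.1 hy with rfl | rfl
          exacts [hNU _ ha, hNU _ hb]
        · exact hM'U e he y hy) hcard
    have hcases : N.card = 0 ∨ N.card = 1 ∨ N.card = 2 ∨ N.card = 3 := by omega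
    clear_value M'
    rcases hcases with h | h | h | h
    · obtain rfl := Multiset.card_eq_zero.1 h
      rw [Multiset.map_zero, zero_add] at hdec
      rw [← hdec]
      exact ih hM's hM'U hcard
    · obtain ⟨a, rfl⟩ := Multiset.card_eq_one.1 h
      obtain ⟨A, B, rfl, hA, hB⟩ := ih hM's hM'U hcard
      refine ⟨s(x, a) ::ₘ A, B, by simp [← hdec], ?_, hB⟩
      exact hA.cons_of_forall_notMem (fun e he => hxM' e (by simp [he])) (hN a (by simp))
    · obtain ⟨a, b, rfl⟩ := Multiset.card_eq_two.1 h
      obtain ⟨A, B, rfl, hA, hB⟩ := ih hM's hM'U hcard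
      refine ⟨s(x, a) ::ₘ A, s(x, b) ::ₘ B, by simp [← hdec, Multiset.cons_swap (s(x, b))], ?_, ?_⟩
      · exact hA.cons_of_forall_notMem (fun e he => hxM' e (by simp [he])) (hN a (by simp))
      · exact hB.cons_of_forall_notMem (fun e he => hxM' e (by simp [he])) (hN b (by simp))
    · obtain ⟨a, b, c, rfl⟩ := Multiset.card_eq_three.1 h
      have hMabc : M = s(x, a) ::ₘ s(x, b) ::ₘ s(x, c) ::ₘ M' := by simp [← hdec]
      have ha := hN a (by simp)
      have hb := hN b (by simp)
      have hc := hN c (by simp)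
      rw [hMabc] at hM ⊢
      rcases hM.split_off with h | h
      · exact exists_forests_of_split_off hxM' ha hb hc (extend a (by simp) b (by simp) h)
      -- Rotate the three edges so that `xb`, `xc` is the split pair and `xa` the pendant edge.
      · rw [Multiset.cons_swap (s(x, a)), Multiset.cons_swap (s(x, a))]
        exact exists_forests_of_split_off hxM' hb hc ha (extend b (by simp) c (by simp) h)

end Multigraph

open SimpleGraph

/-! ### Forests, Ramsey graphs and minimal Ramsey graphs in terms of sparsity. -/

section Sparsity

variable {V : Type*} [Finite V] {G H : SimpleGraph V}

/-- The edges of a finite simple graph, as a multiset. -/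
noncomputable def edgeMultiset (G : SimpleGraph V) : Multiset (Sym2 V) :=
  (Set.toFinite G.edgeSet).toFinset.val

@[simp]
lemma mem_edgeMultiset {e : Sym2 V} : e ∈ edgeMultiset G ↔ e ∈ G.edgeSet := by
  simp [edgeMultiset]

lemma nodup_edgeMultiset : (edgeMultiset G).Nodup := Finset.nodup _

lemma edgeMultiset_mono (h : G ≤ H) : edgeMultiset G ≤ edgeMultiset H :=
  (Multiset.le_iff_subset nodup_edgeMultiset).2 fun e he => by
    rw [mem_edgeMultiset] at he ⊢
    exact edgeSet_mono h he

lemma edgesWithin_univ {V : Type*} [Fintype V] (M : Multiset (Sym2 V)) :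
    edgesWithin M Finset.univ = M.card := by
  simp [edgesWithin]

lemma edgesWithin_le_card_induce (G : SimpleGraph V) (U : Finset V) :
    edgesWithin (edgeMultiset G) U ≤ (edgeMultiset (G.induce (U : Set V))).card := by
  classical
  rw [← Multiset.card_map (Sym2.map Subtype.val), edgesWithin, Multiset.countP_eq_card_filter]
  refine Multiset.card_le_card ((Multiset.le_iff_subset (nodup_edgeMultiset.filter _)).2 ?_)
  intro e he
  obtain ⟨he, heU⟩ := Multiset.mem_filter.1 he
  induction e with | _ a b
  refine Multiset.mem_map.2 ⟨s(⟨a, heU a (by simp)⟩, ⟨b, heU b (by simp)⟩), ?_, rfl⟩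
  simpa using he

/-- A finite acyclic graph on a nonempty vertex type has fewer edges than vertices. -/
lemma SimpleGraph.IsAcyclic.card_edgeMultiset_lt [Nonempty V] (hG : G.IsAcyclic) :
    (edgeMultiset G).card + 1 ≤ Nat.card V := by
  classical
  have := Fintype.ofFinite V
  obtain ⟨T, hGT, -, hT⟩ := connected_top.exists_isTree_le_of_le_of_isAcyclic le_top hG
  rw [Nat.card_eq_fintype_card, ← hT.card_edgeFinset]
  refine Nat.add_le_add_right ((Multiset.card_le_card (edgeMultiset_mono hGT)).trans ?_) 1
  exact Finset.card_le_card fun e he => by simpa using he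

lemma isSparse_one_of_isAcyclic (hG : G.IsAcyclic) : IsSparse 1 (edgeMultiset G) := by
  intro U hU
  have : Nonempty (U : Set V) := hU.to_subtype
  have h₁ := (hG.induce (U : Set V)).card_edgeMultiset_lt
  have h₂ := edgesWithin_le_card_induce G U
  simp only [Nat.card_eq_fintype_card, Finset.coe_sort_coe, Fintype.card_coe] at h₁
  omega

/-- The vertex set of a cycle spans at least as many edges as it has vertices. -/
lemma isAcyclic_of_isSparse_one (hG : IsSparse 1 (edgeMultiset G)) : G.IsAcyclic := by
  classical
  intro a p hp
  have hsub : (p.edges : Multiset (Sym2 V)) ≤ edgeMultiset G :=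
    (Multiset.le_iff_subset (Multiset.coe_nodup.2 hp.edges_nodup)).2 fun e he => by
      rw [mem_edgeMultiset]
      exact p.edges_subset_edgeSet (by simpa using he)
  have h₁ := hG p.support.toFinset ⟨a, by simp⟩
  have h₂ : edgesWithin (p.edges : Multiset (Sym2 V)) p.support.toFinset = p.length := by
    rw [edgesWithin, Multiset.countP_eq_card.2, Multiset.coe_card, p.length_edges]
    intro e he x hx
    rw [List.mem_toFinset]
    exact p.mem_support_of_mem_edges (by simpa using he) hx
  have h₃ : p.support.toFinset.card ≤ p.length := by
    have h : p.support.toFinset = p.support.tail.toFinset := by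
      ext x
      rw [List.mem_toFinset, List.mem_toFinset, p.mem_support_iff]
      refine ⟨?_, .inr⟩
      rintro (rfl | hx)
      exacts [p.end_mem_tail_support hp.not_nil, hx]
    rw [h]
    refine (List.toFinset_card_le _).trans ?_
    simp
  have h₄ := edgesWithin_mono_left (U := p.support.toFinset) hsub
  omega

/-- A finite graph decomposes into two forests if and only if each of its nonempty vertex sets `U`
spans at most `2 |U| - 2` edges. -/
theorem not_isCyclicityRamsey_two_iff :
    ¬ IsCyclicityRamsey 2 G ↔ IsSparse 2 (edgeMultiset G) := by
  classical
  have hacyclic : ¬ IsCyclicityRamsey 2 G ↔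
      ∃ c : G.EdgeLabeling (Fin 2), ∀ i, (c.labelGraph i).IsAcyclic := by
    simp only [IsCyclicityRamsey, IsAcyclic, not_forall, not_exists]
  rw [hacyclic]
  constructor
  · rintro ⟨c, hc⟩ U hU
    have hle : edgeMultiset G ≤ edgeMultiset (c.labelGraph 0) + edgeMultiset (c.labelGraph 1) := by
      refine (Multiset.le_iff_subset nodup_edgeMultiset).2 fun e he => ?_
      induction e with | _ a b
      simp only [mem_edgeMultiset, mem_edgeSet, Multiset.mem_add,
        EdgeLabeling.labelGraph_adj] at he ⊢
      have : ∀ i : Fin 2, i = 0 ∨ i = 1 := by decide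
      rcases this (c ⟨s(a, b), he⟩) with h | h
      exacts [.inl ⟨he, h⟩, .inr ⟨he, h⟩]
    have h₁ := edgesWithin_mono_left (U := U) hle
    have h₂ := isSparse_one_of_isAcyclic (hc 0) U hU
    have h₃ := isSparse_one_of_isAcyclic (hc 1) U hU
    rw [edgesWithin_add] at h₁
    omega
  · intro h
    have := Fintype.ofFinite V
    obtain ⟨A, B, hAB, hA, hB⟩ := h.exists_forests (U := Finset.univ) (by simp)
    have key : ∀ (H : SimpleGraph V) (M : Multiset (Sym2 V)), IsSparse 1 M →
        (∀ a b, H.Adj a b → s(a, b) ∈ M) → H.IsAcyclic := fun H M hM h =>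
      isAcyclic_of_isSparse_one <| hM.mono <|
        (Multiset.le_iff_subset nodup_edgeMultiset).2 fun e he => by
          induction e with | _ a b
          exact h a b (by simpa using he)
    refine ⟨fun e => if e.1 ∈ A then 0 else 1, Fin.forall_fin_two.2 ⟨key _ A hA ?_, key _ B hB ?_⟩⟩
    · intro a b hab
      obtain ⟨_, h⟩ := (EdgeLabeling.labelGraph_adj _ _).1 hab
      by_contra hA
      simp [hA] at h
    · intro a b hab
      obtain ⟨hadj, h⟩ := (EdgeLabeling.labelGraph_adj _ _).1 hab
      have hmem : s(a, b) ∈ edgeMultiset G := by simpa using hadj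
      rw [hAB, Multiset.mem_add] at hmem
      exact hmem.resolve_left fun hA => by simp [hA] at h

/-- Ramsey graphs for cyclicity are preserved by injective homomorphisms. -/
lemma IsCyclicityRamsey.of_injective {V W : Type*} {r : ℕ} {G : SimpleGraph V} {H : SimpleGraph W}
    (hG : IsCyclicityRamsey r G) (f : G →g H) (hf : Function.Injective f) :
    IsCyclicityRamsey r H := by
  intro c
  obtain ⟨i, a, p, hp⟩ := hG (c.pullback f)
  let g : (c.pullback f).labelGraph i →g c.labelGraph i :=
    ⟨f, fun {x y} h => by
      obtain ⟨h₁, h₂⟩ := (EdgeLabeling.labelGraph_adj _ _).1 h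
      exact (EdgeLabeling.labelGraph_adj _ _).2 ⟨f.map_adj h₁, h₂⟩⟩
  exact ⟨i, f a, p.map g, (Walk.isCycle_map_iff_of_injective (f := g) hf).2 hp⟩

/-- The minimal Ramsey graphs for cyclicity with two colours are the circuits of the `(2, 2)`-sparse
graphs. -/
theorem isMinimalCyclicityRamsey_two_iff [Fintype V] :
    IsMinimalCyclicityRamsey 2 G ↔ (edgeMultiset G).card + 1 = 2 * Fintype.card V ∧
      ∀ U : Finset V, U.Nonempty → U ≠ Finset.univ →
        edgesWithin (edgeMultiset G) U + 2 ≤ 2 * U.card := by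
  classical
  constructor
  · rintro ⟨hG, hmin⟩
    have hproper : ∀ U : Finset V, U.Nonempty → U ≠ Finset.univ →
        edgesWithin (edgeMultiset G) U + 2 ≤ 2 * U.card := by
      intro U hU hne
      have hind : ¬ IsCyclicityRamsey 2 (G.induce (U : Set V)) := by
        intro h
        refine hmin ((⊤ : G.Subgraph).induce (U : Set V)) (fun h => hne ?_) ?_
        · have := congrArg Subgraph.verts h
          exact Finset.coe_eq_univ.1 this
        · refine h.of_injective ⟨fun x => ⟨x.1, x.2⟩, fun {x y} h => ?_⟩ fun x y h => ?_
          · exact ⟨x.2, y.2, h⟩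
          · exact Subtype.ext (congrArg Subtype.val h)
      have h₁ := not_isCyclicityRamsey_two_iff.1 hind Finset.univ
        (Finset.univ_nonempty_iff.2 hU.to_subtype)
      have h₂ := edgesWithin_le_card_induce G U
      rw [edgesWithin_univ] at h₁
      simp only [Finset.card_univ, Finset.coe_sort_coe, Fintype.card_coe] at h₁
      omega
    refine ⟨?_, hproper⟩
    have hns := mt not_isCyclicityRamsey_two_iff.2 (not_not.2 hG)
    simp only [IsSparse, not_forall] at hns
    obtain ⟨U, hU, hcard⟩ := hns
    obtain rfl : U = Finset.univ := by
      by_contra hne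
      exact hcard (hproper U hU hne)
    rw [edgesWithin_univ, Finset.card_univ] at hcard
    have hpos := Finset.card_pos.2 hU
    rw [Finset.card_univ] at hpos
    -- By minimality, deleting any one edge leaves a sparse graph, with at most `2|V| - 2` edges.
    suffices hle : (edgeMultiset G).card ≤ 2 * Fintype.card V - 1 by omega
    obtain ⟨e, he⟩ : ∃ e, e ∈ edgeMultiset G := by
      refine Multiset.card_pos_iff_exists_mem.1 ?_
      omega
    rw [mem_edgeMultiset] at he
    have hdel : ¬ IsCyclicityRamsey 2 (G.deleteEdges {e}) := by
      intro h
      refine hmin ((⊤ : G.Subgraph).deleteEdges {e}) (fun h => ?_) ?_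
      · induction e with | _ a b
        have := congrArg (Subgraph.Adj · a b) h
        simp only [Subgraph.deleteEdges_adj, Set.mem_singleton_iff, not_true_eq_false, and_false,
          Subgraph.top_adj, eq_iff_iff, false_iff] at this
        exact this he
      · refine h.of_injective ⟨fun x => ⟨x, trivial⟩, fun {x y} h => ?_⟩ fun x y h => ?_
        · rw [deleteEdges_adj] at h
          rwa [Subgraph.coe_adj, Subgraph.deleteEdges_adj, Subgraph.top_adj]
        · exact congrArg Subtype.val h
    have h₁ := not_isCyclicityRamsey_two_iff.1 hdel Finset.univ hU
    have h₂ : edgeMultiset G ≤ e ::ₘ edgeMultiset (G.deleteEdges {e}) :=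
      (Multiset.le_iff_subset nodup_edgeMultiset).2 fun f hf => by
        rw [mem_edgeMultiset] at hf
        simp only [Multiset.mem_cons, mem_edgeMultiset, edgeSet_deleteEdges, Set.mem_sdiff,
          Set.mem_singleton_iff]
        tauto
    have h₃ := Multiset.card_le_card h₂
    rw [edgesWithin_univ, Finset.card_univ] at h₁
    rw [Multiset.card_cons] at h₃
    omega
  · rintro ⟨hcard, hproper⟩
    have hpos : 0 < Fintype.card V := by omega
    have hU : (Finset.univ : Finset V).Nonempty := by
      rwa [← Finset.card_pos, Finset.card_univ]
    refine ⟨?_, fun H hH hR => hH ?_⟩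
    · by_contra h
      have := not_isCyclicityRamsey_two_iff.1 h Finset.univ hU
      rw [edgesWithin_univ, Finset.card_univ] at this
      omega
    · have hle := edgeMultiset_mono H.spanningCoe_le
      have hspan : IsCyclicityRamsey 2 H.spanningCoe :=
        hR.of_injective ⟨Subtype.val, fun h => h⟩ Subtype.val_injective
      have hns := mt not_isCyclicityRamsey_two_iff.2 (not_not.2 hspan)
      simp only [IsSparse, not_forall] at hns
      obtain ⟨U, hU, hns⟩ := hns
      obtain rfl : U = Finset.univ := by
        by_contra hne
        have := hproper U hU hne
        have := edgesWithin_mono_left (U := U) hle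
        omega
      rw [edgesWithin_univ, Finset.card_univ] at hns
      -- Only the whole vertex set can violate sparsity, and it does so only if no edge of `G` is
      -- missing from `H`.
      have heq := Multiset.eq_of_le_of_card_le hle (by omega)
      have hadj : ∀ a b, G.Adj a b → H.Adj a b := fun a b hab => by
        have : s(a, b) ∈ edgeMultiset G := by simpa using hab
        rw [← heq] at this
        simpa using this
      have hverts : ∀ z, z ∈ H.verts := by
        intro z
        by_contra hz
        -- A vertex missing from `H` would be isolated in `G`, so the remaining vertices would span
        -- all `2|V| - 1` edges.
        have hcnt : edgesWithin (edgeMultiset G) (Finset.univ.erase z) =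
            edgesWithin (edgeMultiset G) Finset.univ := by
          refine edgesWithin_erase_of_forall_notMem fun e he hze => ?_
          obtain ⟨y, rfl⟩ := Sym2.mem_iff_exists.1 hze
          exact hz (hadj z y (by simpa using he)).fst_mem
        have hcard' := Finset.card_erase_of_mem (Finset.mem_univ z)
        rw [Finset.card_univ] at hcard'
        rw [edgesWithin_univ] at hcnt
        by_cases hne : (Finset.univ.erase z).Nonempty
        · have := hproper _ hne (Finset.erase_ssubset (Finset.mem_univ z)).ne
          omega
        · rw [Finset.not_nonempty_iff_eq_empty] at hne
          rw [hne] at hcnt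
          rw [edgesWithin_empty] at hcnt
          omega
      ext a b
      · simp [hverts a]
      · exact ⟨fun h => h.adj_sub, fun h => hadj a b h⟩

end Sparsity

/-! ### Edge counts in the three constructions. -/

section Constructions

variable {V : Type*} {G : SimpleGraph V} {u v w : V}

lemma card_eq_card_eraseNone_add (U : Finset (Option V)) [Decidable (none ∈ U)] :
    U.card = U.eraseNone.card + if none ∈ U then 1 else 0 := by
  split_ifs with h
  · rw [Finset.card_eraseNone_of_mem h]
    have := Finset.card_pos.2 ⟨_, h⟩
    omega
  · rw [Finset.card_eraseNone_of_not_mem h, add_zero]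

lemma eraseNone_univ [Fintype V] :
    (Finset.univ : Finset (Option V)).eraseNone = Finset.univ := by
  ext
  simp

lemma eq_univ_of_eraseNone_eq_univ [Fintype V] {U : Finset (Option V)}
    (h : U.eraseNone = Finset.univ) (hU : none ∈ U) : U = Finset.univ := by
  refine Finset.eq_univ_of_forall (Option.rec hU fun a => ?_)
  rw [← Finset.mem_eraseNone, h]
  exact Finset.mem_univ a

lemma card_filter_mem_pair [DecidableEq V] (hvw : v ≠ w) (U : Finset V) :
    (({v, w} : Finset V).filter (· ∈ U)).card =
      (if v ∈ U then 1 else 0) + if w ∈ U then 1 else 0 := by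
  rw [Finset.card_filter, Finset.sum_pair hvw]

lemma card_filter_mem_triple [DecidableEq V] (huv : u ≠ v) (huw : u ≠ w) (hvw : v ≠ w)
    (U : Finset V) :
    (({u, v, w} : Finset V).filter (· ∈ U)).card =
      (if u ∈ U then 1 else 0) + (if v ∈ U then 1 else 0) + if w ∈ U then 1 else 0 := by
  rw [Finset.card_filter, Finset.sum_insert (by simp [huv, huw]), Finset.sum_pair hvw, add_assoc]

variable [Finite V]

lemma edgeMultiset_joinNewVertex (S : Finset V) :
    edgeMultiset (joinNewVertex G S) = (edgeMultiset G).map (Sym2.map some) +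
      S.val.map (fun a => s(none, some a)) := by
  refine (Multiset.Nodup.ext nodup_edgeMultiset ?_).2 fun e => ?_
  · refine Multiset.nodup_add.2 ⟨nodup_edgeMultiset.map (Sym2.map.injective (Option.some_injective V)),
      S.nodup.map fun a b h => by simpa using h, Multiset.disjoint_left.2 ?_⟩
    intro e h₁ h₂
    obtain ⟨f, -, rfl⟩ := Multiset.mem_map.1 h₁
    obtain ⟨a, -, h⟩ := Multiset.mem_map.1 h₂
    have : (none : Option V) ∈ Sym2.map some f := h ▸ Sym2.mem_mk_left _ _
    simp at this
  · have hmap : ∀ p q : Option V, s(p, q) ∈ (edgeMultiset G).map (Sym2.map some) ↔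
        ∃ a b, G.Adj a b ∧ p = some a ∧ q = some b := by
      intro p q
      rw [Multiset.mem_map]
      constructor
      · rintro ⟨f, hf, h⟩
        induction f with | _ a b
        rw [mem_edgeMultiset, mem_edgeSet] at hf
        rw [Sym2.map_mk, Sym2.eq_iff] at h
        rcases h with ⟨rfl, rfl⟩ | ⟨rfl, rfl⟩
        exacts [⟨a, b, hf, rfl, rfl⟩, ⟨b, a, hf.symm, rfl, rfl⟩]
      · rintro ⟨a, b, h, rfl, rfl⟩
        exact ⟨s(a, b), by simpa using h, rfl⟩
    induction e with | _ p q
    rw [Multiset.mem_add, hmap, mem_edgeMultiset, mem_edgeSet]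
    rcases p with _ | a <;> rcases q with _ | b <;> simp [joinNewVertex]

lemma edgesWithin_joinNewVertex [DecidableEq V] (S : Finset V) (U : Finset (Option V)) :
    edgesWithin (edgeMultiset (joinNewVertex G S)) U =
      edgesWithin (edgeMultiset G) U.eraseNone +
        if none ∈ U then (S.filter (· ∈ U.eraseNone)).card else 0 := by
  classical
  rw [edgeMultiset_joinNewVertex, edgesWithin_add]
  congr 1
  · rw [edgesWithin, Multiset.countP_map, ← Multiset.countP_eq_card_filter, edgesWithin]
    refine Multiset.countP_congr rfl fun e _ => ?_
    induction e with | _ a b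
    simp
  · rw [edgesWithin, Multiset.countP_map]
    split_ifs with h
    · simp [h, Finset.card, Finset.filter_val]
    · simp [h]

lemma edgesWithin_deleteEdges_add [DecidableEq V] (h : G.Adj v w) (U : Finset V) :
    edgesWithin (edgeMultiset (G.deleteEdges {s(v, w)})) U +
      (if v ∈ U ∧ w ∈ U then 1 else 0) = edgesWithin (edgeMultiset G) U := by
  have : edgeMultiset G = s(v, w) ::ₘ edgeMultiset (G.deleteEdges {s(v, w)}) := by
    refine (Multiset.Nodup.ext nodup_edgeMultiset ?_).2 fun e => ?_
    · exact Multiset.nodup_cons.2 ⟨by simp, nodup_edgeMultiset⟩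
    · simp only [Multiset.mem_cons, mem_edgeMultiset, edgeSet_deleteEdges, Set.mem_sdiff,
        Set.mem_singleton_iff]
      by_cases he : e = s(v, w)
      · simpa [he] using h
      · simp [he]
  rw [this, edgesWithin_cons]
  congr

/-- The deleted edge is counted on the left, which avoids truncated subtraction; the two later
counts do the same. -/
lemma edgesWithin_pathExtension [DecidableEq V] (huv : u ≠ v) (huw : u ≠ w) (h : G.Adj v w)
    (U : Finset (Option V)) :
    edgesWithin (edgeMultiset (pathExtension G u v w)) U +
      (if some v ∈ U ∧ some w ∈ U then 1 else 0) = edgesWithin (edgeMultiset G) U.eraseNone +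
        if none ∈ U then (if some u ∈ U then 1 else 0) + (if some v ∈ U then 1 else 0) +
          (if some w ∈ U then 1 else 0) else 0 := by
  have hS : ({u, v, w} : Set V) = (({u, v, w} : Finset V) : Set V) := by simp
  rw [pathExtension, edgesWithin_deleteEdges_add (by exact h), hS, edgesWithin_joinNewVertex,
    card_filter_mem_triple huv huw h.ne]
  simp only [Finset.mem_eraseNone]

lemma edgesWithin_diamondExtension [DecidableEq V] (h : G.Adj v w)
    (U : Finset (Option (Option V))) :
    edgesWithin (edgeMultiset (diamondExtension G v w)) U +
      (if some (some v) ∈ U ∧ some (some w) ∈ U then 1 else 0) =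
      edgesWithin (edgeMultiset G) U.eraseNone.eraseNone +
        (if some none ∈ U then (if some (some v) ∈ U then 1 else 0) +
          (if some (some w) ∈ U then 1 else 0) else 0) +
        if none ∈ U then (if some none ∈ U then 1 else 0) + (if some (some v) ∈ U then 1 else 0) +
          (if some (some w) ∈ U then 1 else 0) else 0 := by
  have hS : ({v, w} : Set V) = (({v, w} : Finset V) : Set V) := by simp
  rw [diamondExtension, edgesWithin_pathExtension (by simp) (by simp) (by exact h), hS,
    edgesWithin_joinNewVertex, card_filter_mem_pair h.ne]
  simp only [Finset.mem_eraseNone]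

lemma edgesWithin_doublePathExtension [DecidableEq V] (huv : G.Adj u v) (hvw : G.Adj v w)
    (huw : u ≠ w) (U : Finset (Option (Option V))) :
    edgesWithin (edgeMultiset (doublePathExtension G u v w)) U +
      (if some (some v) ∈ U ∧ some (some w) ∈ U then 1 else 0) +
      (if some (some u) ∈ U ∧ some (some v) ∈ U then 1 else 0) =
      edgesWithin (edgeMultiset G) U.eraseNone.eraseNone +
        (if some none ∈ U then (if some (some u) ∈ U then 1 else 0) +
          (if some (some v) ∈ U then 1 else 0) + (if some (some w) ∈ U then 1 else 0) else 0) +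
        if none ∈ U then (if some (some u) ∈ U then 1 else 0) +
          (if some (some v) ∈ U then 1 else 0) + (if some (some w) ∈ U then 1 else 0) else 0 := by
  have hS : ({u, v, w} : Set V) = (({u, v, w} : Finset V) : Set V) := by simp
  have hS' : ({some u, some v, some w} : Set (Option V)) =
      (({some u, some v, some w} : Finset (Option V)) : Set (Option V)) := by simp
  rw [doublePathExtension, Set.insert_eq s(some (some u), some (some v)), ← deleteEdges_deleteEdges,
    edgesWithin_deleteEdges_add (deleteEdges_adj.2 ⟨by exact hvw, ?_⟩),
    edgesWithin_deleteEdges_add (by exact huv), hS, hS', edgesWithin_joinNewVertex,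
    edgesWithin_joinNewVertex, card_filter_mem_triple huv.ne huw hvw.ne, card_filter_mem_triple]
  · simp only [Finset.mem_eraseNone]
  · simp [huv.ne]
  · simp [huw]
  · simp [hvw.ne]
  · simp [huw.symm, huv.ne']

lemma IsMinimalCyclicityRamsey.edgesWithin_cases [Fintype V] (hG : IsMinimalCyclicityRamsey 2 G)
    (U : Finset V) :
    (U = ∅ ∧ edgesWithin (edgeMultiset G) U = 0 ∧ U.card = 0) ∨
    (U = Finset.univ ∧ edgesWithin (edgeMultiset G) U + 1 = 2 * U.card) ∨
    (U ≠ Finset.univ ∧ edgesWithin (edgeMultiset G) U + 2 ≤ 2 * U.card) := by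
  obtain ⟨hcard, hproper⟩ := isMinimalCyclicityRamsey_two_iff.1 hG
  rcases U.eq_empty_or_nonempty with rfl | hU
  · exact .inl ⟨rfl, edgesWithin_empty, rfl⟩
  · by_cases h : U = Finset.univ
    · subst h
      exact .inr (.inl ⟨rfl, by rwa [edgesWithin_univ, Finset.card_univ]⟩)
    · exact .inr (.inr ⟨h, hproper U hU h⟩)

theorem IsMinimalCyclicityRamsey.pathExtension (hG : IsMinimalCyclicityRamsey 2 G)
    (huv : u ≠ v) (huw : u ≠ w) (h : G.Adj v w) :
    IsMinimalCyclicityRamsey 2 (pathExtension G u v w) := by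
  classical
  have := Fintype.ofFinite V
  have hcnt := edgesWithin_pathExtension huv huw h
  rw [isMinimalCyclicityRamsey_two_iff]
  constructor
  · have h₁ := hcnt Finset.univ
    rw [edgesWithin_univ, eraseNone_univ, edgesWithin_univ] at h₁
    have h₂ := (isMinimalCyclicityRamsey_two_iff.1 hG).1
    simp only [Finset.mem_univ, and_self, if_true] at h₁
    rw [Fintype.card_option]
    omega
  · intro U hU hne
    have h₁ := hcnt U
    have h₂ := card_eq_card_eraseNone_add U
    have h₃ := Finset.card_pos.2 hU
    simp only [← Finset.mem_eraseNone] at h₁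
    rcases hG.edgesWithin_cases U.eraseNone with ⟨h₄, h₅, h₆⟩ | ⟨h₄, h₅⟩ | ⟨h₄, h₅⟩
    · simp only [h₄, Finset.notMem_empty, and_self, if_false] at h₁
      split_ifs at h₁ h₂ <;> simp_all
    · have : none ∉ U := fun h => hne (eq_univ_of_eraseNone_eq_univ h₄ h)
      simp only [this, if_false] at h₁ h₂
      simp only [h₄, Finset.mem_univ, and_self, if_true] at h₁ h₂ h₅
      omega
    -- The new vertex gains three edges only if `v` and `w` are both present, and then `vw` is lost:
    -- the net gain is at most two.
    · split_ifs at h₁ h₂ <;> first | omega | tauto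

/-- The result for the first construction cannot be quoted: the intermediate graph contains `G`
properly, so it is not minimal. Both new vertices are counted at once instead. -/
theorem IsMinimalCyclicityRamsey.diamondExtension (hG : IsMinimalCyclicityRamsey 2 G)
    (h : G.Adj v w) : IsMinimalCyclicityRamsey 2 (diamondExtension G v w) := by
  classical
  have := Fintype.ofFinite V
  have hcnt := edgesWithin_diamondExtension h
  rw [isMinimalCyclicityRamsey_two_iff]
  constructor
  · have h₁ := hcnt Finset.univ
    rw [edgesWithin_univ, eraseNone_univ, eraseNone_univ, edgesWithin_univ] at h₁
    have h₂ := (isMinimalCyclicityRamsey_two_iff.1 hG).1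
    simp only [Finset.mem_univ, and_self, if_true] at h₁
    rw [Fintype.card_option, Fintype.card_option]
    omega
  · intro U hU hne
    have h₁ := hcnt U
    have h₂ := card_eq_card_eraseNone_add U
    have h₃ := card_eq_card_eraseNone_add U.eraseNone
    have h₄ := Finset.card_pos.2 hU
    simp only [← Finset.mem_eraseNone (s := U), ← Finset.mem_eraseNone (s := U.eraseNone)] at h₁ h₃
    rcases hG.edgesWithin_cases U.eraseNone.eraseNone with ⟨h₅, h₆, h₇⟩ | ⟨h₅, h₆⟩ | ⟨h₅, h₆⟩
    · simp only [h₅, edgesWithin_empty, Finset.notMem_empty, and_self, if_false, add_zero] at h₁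
      split_ifs at h₁ h₂ h₃ <;> omega
    · have hnot : ¬ (none ∈ U ∧ none ∈ U.eraseNone) := fun h =>
        hne (eq_univ_of_eraseNone_eq_univ (eq_univ_of_eraseNone_eq_univ h₅ h.2) h.1)
      simp only [h₅, Finset.mem_univ, and_self, if_true] at h₁ h₃ h₆
      split_ifs at h₁ h₂ h₃ <;> first | omega | tauto
    · by_cases hv : v ∈ U.eraseNone.eraseNone <;>
        by_cases hw : w ∈ U.eraseNone.eraseNone <;>
        simp only [hv, hw, and_true, and_false, if_true, if_false] at h₁ <;>
        split_ifs at h₁ h₂ h₃ <;> omega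

theorem IsMinimalCyclicityRamsey.doublePathExtension (hG : IsMinimalCyclicityRamsey 2 G)
    (huv : G.Adj u v) (hvw : G.Adj v w) (huw : u ≠ w) :
    IsMinimalCyclicityRamsey 2 (doublePathExtension G u v w) := by
  classical
  have := Fintype.ofFinite V
  have hcnt := edgesWithin_doublePathExtension huv hvw huw
  rw [isMinimalCyclicityRamsey_two_iff]
  constructor
  · have h₁ := hcnt Finset.univ
    rw [edgesWithin_univ, eraseNone_univ, eraseNone_univ, edgesWithin_univ] at h₁
    have h₂ := (isMinimalCyclicityRamsey_two_iff.1 hG).1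
    simp only [Finset.mem_univ, and_self, if_true] at h₁
    rw [Fintype.card_option, Fintype.card_option]
    omega
  · intro U hU hne
    have h₁ := hcnt U
    have h₂ := card_eq_card_eraseNone_add U
    have h₃ := card_eq_card_eraseNone_add U.eraseNone
    have h₄ := Finset.card_pos.2 hU
    simp only [← Finset.mem_eraseNone (s := U), ← Finset.mem_eraseNone (s := U.eraseNone)] at h₁ h₃
    rcases hG.edgesWithin_cases U.eraseNone.eraseNone with ⟨h₅, h₆, h₇⟩ | ⟨h₅, h₆⟩ | ⟨h₅, h₆⟩
    · simp only [h₅, edgesWithin_empty, Finset.notMem_empty, and_self, if_false, add_zero] at h₁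
      split_ifs at h₁ h₂ h₃ <;> omega
    -- At most one new vertex is present: it adds three edges, while `uv` and `vw` are lost, so at
    -- most `2|V| - 1 + 3 - 2 = 2(|V| + 1) - 2` edges remain.
    · have hnot : ¬ (none ∈ U ∧ none ∈ U.eraseNone) := fun h =>
        hne (eq_univ_of_eraseNone_eq_univ (eq_univ_of_eraseNone_eq_univ h₅ h.2) h.1)
      simp only [h₅, Finset.mem_univ, and_self, if_true] at h₁ h₃ h₆
      split_ifs at h₁ h₂ h₃ <;> first | omega | tauto
    · by_cases hu : u ∈ U.eraseNone.eraseNone <;>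
        by_cases hv : v ∈ U.eraseNone.eraseNone <;>
        by_cases hw : w ∈ U.eraseNone.eraseNone <;>
        simp only [hu, hv, hw, and_true, and_false, if_true, if_false] at h₁ <;>
        split_ifs at h₁ h₂ h₃ <;> omega

end Constructions

theorem theorem1p5 {V : Type*} [Finite V] (G : SimpleGraph V)
    (hG : IsMinimalCyclicityRamsey 2 G) :
    (∀ u v w : V, G.Adj u v → G.Adj v w → u ≠ w →
      IsMinimalCyclicityRamsey 2 (pathExtension G u v w)) ∧
    (∀ v w : V, G.Adj v w →
      IsMinimalCyclicityRamsey 2 (diamondExtension G v w)) ∧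
    (∀ u v w : V, G.Adj u v → G.Adj v w → u ≠ w →
      IsMinimalCyclicityRamsey 2 (doublePathExtension G u v w)) :=
  ⟨fun _ _ _ huv hvw huw => hG.pathExtension huv.ne huw hvw,
    fun _ _ hvw => hG.diamondExtension hvw,
    fun _ _ _ huv hvw huw => hG.doublePathExtension huv hvw huw⟩
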